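/- Fix an integer $r>1$ and let $F_r$ be the free group with free basis $a=(a_1,\dots,a_r)$. For a free basis $b$ of $F_r$ let $F^b(n)$ be the set of elements of $F_r$ whose reduced word in the letters $b_1^{\pm1},\dots,b_r^{\pm1}$ has length at most $n$. For a finitely generated right $F_r$-set $S$ and a finite generating set $A\subseteq S$ (that is, $S=AF_r$), put $g^b_{A}(n)=\#\,A F^b(n)$. Two functions $f,g:\mathbb N\to\mathbb N$ are equivalent if for some $C\in\mathbb N$ one has $f(n)\le g(n+C)$ and $g(n)\le f(n+C)$ for all $n$; the growth of $S$ with respect to $b$ is the equivalence class of $g^b_A$, which does not depend on $A$. It is called maximal if it equals the growth, with respect to $b$, of $F_r$ acting on itself by right multiplication. A bijection $f:T\to S$ of right $F_r$-sets is a semi-isomorphism along an automorphism $\varphi$ of $F_r$ if $f(x\circ g)=f(x)\circ\varphi(g)$ for all $x\in T$, $g\in F_r$. Theorem. For every $r>1$ let $\varphi$ be the Nielsen automorphism of $F_r$ with $\varphi(a_2)=a_1a_2$ and $\varphi(a_i)=a_i$ for $i\ne 2$. There is a (non-empty) transitive right $F_r$-set $S$ such that: 1. the growth of $S$ with respect to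 the free basis $\varphi(a)=(a_1,a_1a_2,a_3,\dots,a_r)$ is maximal; 2. there is $\gamma>0$ such that for every finite generating set $A$ of $S$ the inequality $g^{a}_{A}(n)\le(2r-1-\gamma)^n$ holds for all sufficiently large $n$; in particular, the growth of $S$ with respect to the free basis $a$ is not maximal; 3. there is a transitive right $F_r$-set $T$ that is semi-isomorphic to $S$ along $\varphi$ and whose growth with respect to $a$ is maximal. Hence, for a fixed free basis, maximality of the growth is not invariant under semi-isomorphisms. -/

import Mathlib

namespace ActGrowth

open MulOpposite

/-- The standard filtration `F(0) ⊆ F(1) ⊆ ⋯` of a free group `F` attached to a free basis `b`: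
`F(n)` consists of the elements whose reduced word in the letters `b i` and their inverses
has length at most `n`. -/
def filtration {ι F : Type*} [DecidableEq ι] [Group F] (b : FreeGroupBasis ι F) (n : ℕ) : Set F :=
  {g | (b.repr g).norm ≤ n}

section Growth

variable {ι F : Type*} [DecidableEq ι] [Group F] (b : FreeGroupBasis ι F)

/-- The ball `A · F(n)` of radius `n` around `A` in a right `F`-set `S`; a right action of `F` is
an action of `Fᵐᵒᵖ`, and `op g • s` is `s ∘ g`. -/
def ball {S : Type*} [MulAction Fᵐᵒᵖ S] (A : Set S) (n : ℕ) : Set S :=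
  {s | ∃ a ∈ A, ∃ g ∈ filtration b n, op g • a = s}

/-- For a free basis indexed by a finite type and a finite set `A`, all balls are finite. -/
theorem ball_finite [Finite ι] {S : Type*} [MulAction Fᵐᵒᵖ S] {A : Set S} (hA : A.Finite) (n : ℕ) :
    (ball b A n).Finite := by
  have h1 : (filtration b n).Finite := by
    refine Set.Finite.of_finite_image (f := fun g => (b.repr g).toWord)
      ((List.finite_length_le (ι × Bool) n).subset ?_) ?_
    · rintro _ ⟨g, hg, rfl⟩
      exact hg
    · intro x _ y _ h
      exact b.repr.injective (FreeGroup.toWord_injective h)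
  refine (Set.Finite.image2 (fun (a : S) (g : F) => op g • a) hA h1).subset ?_
  rintro s ⟨a, ha, g, hg, rfl⟩
  exact ⟨a, ha, g, hg, rfl⟩

/-- The growth function `n ↦ #(A · F(n))`. -/
noncomputable def growthFunction {S : Type*} [MulAction Fᵐᵒᵖ S] (A : Set S) (n : ℕ) : ℕ :=
  (ball b A n).ncard

end Growth

/-- `A` generates the right `F`-set `S`, that is, `S = A · F`. -/
def IsGeneratingSet (F : Type*) [Group F] {S : Type*} [MulAction Fᵐᵒᵖ S] (A : Set S) : Prop :=
  ∀ s : S, ∃ a ∈ A, ∃ g : F, op g • a = s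

/-- `f ≼ g`: there is `C` with `f n ≤ g (n + C)` for all `n`. -/
def GrowthLE (f g : ℕ → ℕ) : Prop := ∃ C : ℕ, ∀ n : ℕ, f n ≤ g (n + C)

/-- Equivalence of growth functions. -/
def GrowthEquiv (f g : ℕ → ℕ) : Prop := GrowthLE f g ∧ GrowthLE g f

/-- A finitely generated right `F`-set `S` has maximal growth with respect to the free basis `b`
if its growth is the growth of the free right `F`-set of rank one, that is, of `F` acting on itself
by right multiplication and generated by `1`. -/
def HasMaximalGrowth {ι F : Type*} [DecidableEq ι] [Group F] (b : FreeGroupBasis ι F)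
    (S : Type*) [MulAction Fᵐᵒᵖ S] : Prop :=
  (∃ A : Set S, A.Finite ∧ IsGeneratingSet F A) ∧
    ∀ A : Set S, A.Finite → IsGeneratingSet F A →
      GrowthEquiv (growthFunction b A) (growthFunction b ({1} : Set F))

/-- `f : S → T` is a semi-isomorphism of right `F`-sets along the automorphism `φ`. -/
def IsSemiIsomorphism {F : Type*} [Group F] {S T : Type*} [MulAction Fᵐᵒᵖ S] [MulAction Fᵐᵒᵖ T]
    (φ : F ≃* F) (f : S ≃ T) : Prop :=
  ∀ (x : S) (g : F), f (op g • x) = op (φ g) • f x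

/-- The Nielsen automorphism of a free group sending the free generator `x_j` to `x_i x_j` and
fixing every other free generator, where `i ≠ j`. -/
def nielsen {ι : Type*} [DecidableEq ι] (i j : ι) (hij : i ≠ j) : FreeGroup ι ≃* FreeGroup ι :=
  MonoidHom.toMulEquiv
    (FreeGroup.lift fun k => if k = j then FreeGroup.of i * FreeGroup.of j else FreeGroup.of k)
    (FreeGroup.lift fun k => if k = j then (FreeGroup.of i)⁻¹ * FreeGroup.of j else FreeGroup.of k)
    (by ext k; by_cases h : k = j <;> simp [h, hij])
    (by ext k; by_cases h : k = j <;> simp [h, hij])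

/-- The standard free basis `x_0, …, x_{r-1}` of `F_r`. -/
def standardBasis (r : ℕ) : FreeGroupBasis (Fin r) (FreeGroup (Fin r)) :=
  FreeGroupBasis.ofFreeGroup (Fin r)

/-- The Nielsen automorphism `x_1 ↦ x_0 x_1`, `x_k ↦ x_k` for `k ≠ 1`, of `F_r`, where `r > 1`. -/
def nielsenAut (r : ℕ) (hr : 1 < r) : FreeGroup (Fin r) ≃* FreeGroup (Fin r) :=
  nielsen (⟨0, by omega⟩ : Fin r) ⟨1, hr⟩ (by simp)

end ActGrowth

namespace ActGrowth

open FreeGroup MulOpposite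

/-! Write `q = 2r - 1`, let `φ` be the Nielsen automorphism and let `|·|` be length in the standard
basis `a`. When letters are prepended at random to a reduced word `L`, the length of `φ(L)` grows by
more than one per letter on average. Hence, for some `ε > 0`, at least `c * q ^ n` words obtained by
`n` prependings have all their nonempty suffixes `L` satisfying `(1 + ε)|L| ≤ |φ(L)| + 4`
(`exists_le_card_prependings`).

Let `G` (`stretched`) be the set of `p` with `(1 + ε)|φ⁻¹(p)| ≤ |p| + const`. It is exponentially
thin in `a`-balls: if `|p| ≤ n`, then `φ⁻¹(p)` lies in a ball of radius about `n / (1 + ε)`, so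
there are at most a constant times `q ^ (n / (1 + ε))` such `p` (`ncard_stretched_le`). In
`φ(a)`-balls it has positive density, by the drift above.

The set `S` is cut out of the Cayley tree: keep the elements whose reduced word changes generator
only at points of `G`, and let a letter fix a point that it would move out of the set. Outside `G`
only one line continues, so an `a`-ball of `S` exceeds the corresponding part of `G` by at most a
linear factor (`ncard_admissible_norm_le`), and its growth rate is below `q`. The good words trace
paths inside `G`, where the action is honest multiplication, so they give distinct points of the
`φ(a)`-ball (`card_prependings_le_growthFunction`). A lower bound `c * q ^ n` suffices for
maximality, since balls in `F` have at most `3 * q ^ n` elements and constants are absorbed by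
shifting `n`. Finally `T` is `S` with the action precomposed with `φ`. -/

theorem isReduced_cons_cons_iff {ι : Type*} {c d : ι × Bool} {L : List (ι × Bool)}
    (h : IsReduced (d :: L)) : IsReduced (c :: d :: L) ↔ c ≠ (d.1, !d.2) := by
  rw [isReduced_cons_cons]
  obtain ⟨c, b⟩ := c
  obtain ⟨d, e⟩ := d
  simp only [h, and_true, ne_eq, Prod.mk.injEq, not_and]
  refine imp_congr_right fun _ => ?_
  cases b <;> cases e <;> simp

/-! ### Counting reduced words -/

section Counting

variable {ι : Type*} [DecidableEq ι] [Fintype ι]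

/-- The words obtained from `L₀` by prepending `n` letters one at a time, all intermediate results
satisfying `P`. -/
noncomputable def prependings (P : List (ι × Bool) → Prop) (L₀ : List (ι × Bool)) :
    ℕ → Finset (List (ι × Bool))
  | 0 => {L₀}
  | n + 1 => by
    classical
    exact ((Finset.univ ×ˢ prependings P L₀ n).image fun p => p.1 :: p.2).filter P

theorem mem_prependings_succ {P : List (ι × Bool) → Prop} {L₀ L : List (ι × Bool)} {n : ℕ} :
    L ∈ prependings P L₀ (n + 1) ↔ P L ∧ ∃ c, ∃ L' ∈ prependings P L₀ n, c :: L' = L := by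
  simp only [prependings, Finset.mem_filter, Finset.mem_image, Finset.mem_product,
    Finset.mem_univ, true_and]
  constructor
  · rintro ⟨⟨p, h, rfl⟩, hP⟩
    exact ⟨hP, p.1, p.2, h, rfl⟩
  · rintro ⟨hP, c, L', h, rfl⟩
    exact ⟨⟨(c, L'), h, rfl⟩, hP⟩

open Classical in
theorem sum_prependings_succ (P : List (ι × Bool) → Prop) (L₀ : List (ι × Bool)) (n : ℕ)
    (f : List (ι × Bool) → ℝ) :
    ∑ L ∈ prependings P L₀ (n + 1), f L =
      ∑ L ∈ prependings P L₀ n, ∑ c, if P (c :: L) then f (c :: L) else 0 := by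
  rw [prependings, Finset.sum_filter, Finset.sum_image, Finset.sum_product_right]
  rintro ⟨c, L⟩ - ⟨c', L'⟩ - h
  simpa using h

theorem card_filter_ne (d : ι × Bool) :
    ((Finset.univ.filter fun c : ι × Bool => c ≠ d).card : ℝ) = 2 * Fintype.card ι - 1 := by
  rw [Finset.filter_ne', Finset.card_erase_of_mem (Finset.mem_univ d), Finset.card_univ,
    Fintype.card_prod, Fintype.card_bool, Nat.cast_sub]
  · push_cast; ring
  · have : 0 < Fintype.card ι := Fintype.card_pos_iff.2 ⟨d.1⟩
    omega

theorem isReduced_of_mem_prependings {L : List (ι × Bool)} {n : ℕ}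
    (h : L ∈ prependings IsReduced ([] : List (ι × Bool)) n) : IsReduced L ∧ L.length = n := by
  induction n generalizing L with
  | zero =>
    obtain rfl : L = [] := by simpa [prependings] using h
    simp
  | succ n ih =>
    obtain ⟨hP, c, L', h', rfl⟩ := mem_prependings_succ.1 h
    exact ⟨hP, by simp [(ih h').2]⟩

theorem mem_prependings_of_isReduced {L : List (ι × Bool)} (h : IsReduced L) :
    L ∈ prependings IsReduced ([] : List (ι × Bool)) L.length := by
  induction L with
  | nil => simp [prependings]
  | cons c L ih =>
    exact mem_prependings_succ.2 ⟨h, c, L, ih (h.infix (List.suffix_cons c L).isInfix), rfl⟩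

theorem card_prependings_le (hι : 1 < Fintype.card ι) (n : ℕ) :
    ((prependings IsReduced ([] : List (ι × Bool)) n).card : ℝ) ≤
      2 * (2 * Fintype.card ι - 1 : ℝ) ^ n := by
  classical
  have hι' : (2 : ℝ) ≤ Fintype.card ι := by exact_mod_cast hι
  induction n with
  | zero => simp [prependings]
  | succ n ih =>
    have key := sum_prependings_succ IsReduced ([] : List (ι × Bool)) n fun _ => 1
    simp only [Finset.sum_const, nsmul_eq_mul, mul_one, ← Finset.sum_filter] at key
    rw [key]
    -- The first letter has no predecessor, so it has `q + 1` choices instead of `q`; this is what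
    -- the factor 2 pays for.
    rcases n with _ | n
    · simp only [prependings, Finset.sum_singleton]
      refine (Nat.cast_le.2 (Finset.card_le_univ _)).trans ?_
      rw [Fintype.card_prod, Fintype.card_bool]
      push_cast
      linarith
    · calc _ ≤ ∑ L ∈ prependings IsReduced ([] : List (ι × Bool)) (n + 1),
              (2 * Fintype.card ι - 1 : ℝ) := by
            refine Finset.sum_le_sum fun L hL => ?_
            obtain ⟨hr, hl⟩ := isReduced_of_mem_prependings hL
            obtain ⟨d, L, rfl⟩ := List.exists_of_length_succ L hl
            rw [← card_filter_ne (d.1, !d.2)]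
            exact le_of_eq (by simp only [isReduced_cons_cons_iff hr])
        _ ≤ _ := by
            rw [Finset.sum_const, nsmul_eq_mul, pow_succ _ (n + 1), ← mul_assoc]
            exact mul_le_mul_of_nonneg_right ih (by linarith)

theorem finite_norm_le (n : ℕ) : {g : FreeGroup ι | g.norm ≤ n}.Finite := by
  refine Set.Finite.of_finite_image (f := toWord)
    ((List.finite_length_le (ι × Bool) n).subset ?_) toWord_injective.injOn
  rintro _ ⟨g, hg, rfl⟩
  exact hg

/-- Sum of the sphere bounds; the constant 3 survives the induction because `3 * q ^ n + 2 * q ^ (n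
+ 1) ≤ 3 * q ^ (n + 1)` for `q ≥ 3`. -/
theorem ncard_norm_le (hι : 1 < Fintype.card ι) (n : ℕ) :
    ({g : FreeGroup ι | g.norm ≤ n}.ncard : ℝ) ≤ 3 * (2 * Fintype.card ι - 1 : ℝ) ^ n := by
  classical
  have hι' : (2 : ℝ) ≤ Fintype.card ι := by exact_mod_cast hι
  have h1 : {g : FreeGroup ι | g.norm ≤ n}.ncard ≤
      ∑ k ∈ Finset.range (n + 1), (prependings IsReduced ([] : List (ι × Bool)) k).card := by
    refine le_trans ?_ Finset.card_biUnion_le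
    rw [← Set.ncard_coe_finset]
    refine Set.ncard_le_ncard_of_injOn toWord ?_ toWord_injective.injOn
    intro g hg
    simp only [Finset.coe_biUnion, Set.mem_iUnion, Finset.mem_coe, Finset.mem_range]
    exact ⟨g.norm, Nat.lt_succ_of_le hg, mem_prependings_of_isReduced isReduced_toWord⟩
  refine (Nat.cast_le.2 h1).trans ?_
  push_cast
  refine (Finset.sum_le_sum fun k _ => card_prependings_le hι k).trans ?_
  clear h1
  induction n with
  | zero => simp; norm_num
  | succ n ih =>
    rw [Finset.sum_range_succ, pow_succ]
    have : 0 ≤ (2 * Fintype.card ι - 1 : ℝ) ^ n := pow_nonneg (by linarith) n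
    nlinarith

/-- A lower bound for the number of reduced words all of whose suffixes are good, from a
nonnegative weight `w` which is at least `1` on bad words and decreases on average. -/
theorem le_card_prependings {P : List (ι × Bool) → Prop} (w : List (ι × Bool) → ℝ)
    (hP : ∀ L, ¬ P L → 1 ≤ w L)
    (hw : ∀ d L, IsReduced (d :: L) →
      ∑ c ∈ Finset.univ.filter (fun c : ι × Bool => c ≠ (d.1, !d.2)), w (c :: d :: L) ≤
        (2 * Fintype.card ι - 1) * w (d :: L))
    (d₀ : ι × Bool) (hw₀ : ∀ L, 0 ≤ w L) (n : ℕ) :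
    (2 * Fintype.card ι - 1 : ℝ) ^ n * (1 - w [d₀]) ≤
      (prependings (fun L => IsReduced L ∧ P L) [d₀] n).card := by
  classical
  have hne : ∀ n, ∀ L ∈ prependings (fun L => IsReduced L ∧ P L) [d₀] n,
      IsReduced L ∧ L ≠ [] := by
    intro n L hL
    rcases n with _ | n
    · obtain rfl : L = [d₀] := by simpa [prependings] using hL
      simp
    · obtain ⟨h, c, L', -, rfl⟩ := mem_prependings_succ.1 hL
      exact ⟨h.1, by simp⟩
  have hι : (1 : ℝ) ≤ Fintype.card ι := by
    exact_mod_cast Fintype.card_pos_iff.2 ⟨d₀.1⟩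
  -- The total of `1 - w` over surviving words grows at least by the factor `q`: averaging gives
  -- this for all reduced extensions, and those that violate `P` have `1 - w ≤ 0`, so dropping them
  -- only helps.
  have main : (2 * Fintype.card ι - 1 : ℝ) ^ n * (1 - w [d₀]) ≤
      ∑ L ∈ prependings (fun L => IsReduced L ∧ P L) [d₀] n, (1 - w L) := by
    induction n with
    | zero => simp [prependings]
    | succ n ih =>
      rw [sum_prependings_succ, pow_succ', mul_assoc]
      refine (mul_le_mul_of_nonneg_left ih (by linarith)).trans ?_
      rw [Finset.mul_sum]
      refine Finset.sum_le_sum fun L hL => ?_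
      obtain ⟨hr, hL0⟩ := hne n L hL
      obtain ⟨d, L, rfl⟩ := List.exists_cons_of_ne_nil hL0
      calc (2 * Fintype.card ι - 1 : ℝ) * (1 - w (d :: L)) ≤
            ∑ c ∈ Finset.univ.filter (fun c : ι × Bool => c ≠ (d.1, !d.2)),
              (1 - w (c :: d :: L)) := by
            rw [Finset.sum_sub_distrib, Finset.sum_const, nsmul_eq_mul, mul_one, card_filter_ne]
            linarith [hw d L hr]
        _ ≤ _ := by
            rw [Finset.sum_filter]
            refine Finset.sum_le_sum fun c _ => ?_
            rw [isReduced_cons_cons_iff hr]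
            by_cases h1 : c ≠ (d.1, !d.2) <;> by_cases h2 : P (c :: d :: L) <;> simp [h1, h2]
            simpa using hP _ h2
  refine main.trans ((Finset.sum_le_sum fun L _ => ?_).trans_eq
    (by rw [Finset.sum_const, nsmul_eq_mul, mul_one]))
  linarith [hw₀ L]

end Counting

/-! ### Cancellation in images under the Nielsen automorphism -/

section Substitution

theorem mk_cons {ι : Type*} (c : ι × Bool) (L : List (ι × Bool)) :
    mk (c :: L) = mk [c] * mk L := by
  rw [mul_mk, List.singleton_append]

variable {ι : Type*} [DecidableEq ι]

theorem toWord_mk_singleton_mul (c : ι × Bool) (p : FreeGroup ι) :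
    (mk [c] * p).toWord =
      if p.toWord.head? = some (c.1, !c.2) then p.toWord.tail else c :: p.toWord := by
  obtain ⟨L, hL, rfl⟩ : ∃ L, IsReduced L ∧ mk L = p := ⟨p.toWord, isReduced_toWord, mk_toWord⟩
  rw [mul_mk, toWord_mk, toWord_mk, hL.reduce_eq, List.singleton_append, reduce.cons,
    hL.reduce_eq]
  rcases L with _ | ⟨d, L⟩
  · simp
  · obtain ⟨c, b⟩ := c
    obtain ⟨d, e⟩ := d
    have : (c = d ∧ b = !e) ↔ (d = c ∧ e = !b) := by
      rw [eq_comm (a := c)]; cases b <;> cases e <;> simp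
    simp [this]

variable {i j : ι} (hij : i ≠ j)

theorem nielsen_mk_of_ne {c : ι × Bool} (hc : c.1 ≠ j) : nielsen i j hij (mk [c]) = mk [c] := by
  obtain ⟨c, b⟩ := c
  replace hc : c ≠ j := hc
  cases b <;> simp [nielsen, hc, FreeGroup.of, FreeGroup.invRev]

theorem nielsen_mk_true : nielsen i j hij (mk [(j, true)]) = mk [(i, true)] * mk [(j, true)] := by
  simp [nielsen, FreeGroup.of]

theorem nielsen_mk_false :
    nielsen i j hij (mk [(j, false)]) = mk [(j, false)] * mk [(i, false)] := by
  simp [nielsen, FreeGroup.of, FreeGroup.invRev]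

/-- The reduced word of the image under `nielsen i j` of the element represented by a word. -/
def image (L : List (ι × Bool)) : List (ι × Bool) := (nielsen i j hij (mk L)).toWord

theorem image_nil : image hij [] = [] := by
  simp [image, ← one_eq_mk]

/-- What the first letter of a reduced word says about the beginning of its image. -/
def HeadSpec (c : ι × Bool) (B A : List (ι × Bool)) : Prop :=
  if c = (i, true) then A = (i, true) :: B ∧ B.head? ≠ some (j, true)
  else if c = (j, true) then A = (i, true) :: (j, true) :: B
  else if c = (i, false) then A.head? = some (i, false) ∨ A.head? = some (j, true)
  else A.head? = some c

theorem toWord_mul_of_ne {c : ι × Bool} {p : FreeGroup ι}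
    (h : p.toWord.head? ≠ some (c.1, !c.2)) : (mk [c] * p).toWord = c :: p.toWord := by
  rw [toWord_mk_singleton_mul, if_neg h]

theorem toWord_mul_of_cons {c : ι × Bool} {p : FreeGroup ι} {B : List (ι × Bool)}
    (h : p.toWord = (c.1, !c.2) :: B) : (mk [c] * p).toWord = B := by
  rw [toWord_mk_singleton_mul, h]; simp

theorem image_cons_of_ne {c : ι × Bool} (hc : c.1 ≠ j) {L : List (ι × Bool)}
    (h : (image hij L).head? ≠ some (c.1, !c.2)) : image hij (c :: L) = c :: image hij L := by
  rw [image, mk_cons, _root_.map_mul, nielsen_mk_of_ne hij hc, toWord_mul_of_ne h, image]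

theorem image_cons_true {L : List (ι × Bool)} (h : (image hij L).head? ≠ some (j, false)) :
    image hij ((j, true) :: L) = (i, true) :: (j, true) :: image hij L := by
  have h1 := toWord_mul_of_ne (c := (j, true)) h
  rw [image, mk_cons, _root_.map_mul, nielsen_mk_true, mul_assoc, toWord_mul_of_ne, h1, image]
  rw [h1]
  simp

theorem image_cons_false {L : List (ι × Bool)} (h : (image hij L).head? ≠ some (i, true)) :
    image hij ((j, false) :: L) = (j, false) :: (i, false) :: image hij L := by
  have h1 := toWord_mul_of_ne (c := (i, false)) h
  rw [image, mk_cons, _root_.map_mul, nielsen_mk_false, mul_assoc, toWord_mul_of_ne, h1, image]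
  rw [h1]
  simp [hij]

theorem image_cons_false_of_cons {L B : List (ι × Bool)} (h : image hij L = (i, true) :: B)
    (hB : B.head? ≠ some (j, true)) : image hij ((j, false) :: L) = (j, false) :: B := by
  have h1 := toWord_mul_of_cons (c := (i, false)) h
  rw [image, mk_cons, _root_.map_mul, nielsen_mk_false, mul_assoc, toWord_mul_of_ne, h1]
  rwa [h1]

theorem image_cons_of_cons {L B : List (ι × Bool)} (h : image hij L = (i, true) :: B) :
    image hij ((i, false) :: L) = B := by
  rw [image, mk_cons, _root_.map_mul, nielsen_mk_of_ne hij hij,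
    toWord_mul_of_cons (c := (i, false)) h]

/-- The change of the length of the image when the letter `c` is put before the letter `d`. -/
def increment (i j : ι) (c d : ι × Bool) : ℤ :=
  1 + (if c = (j, true) then 1 else 0)
    + (if c = (j, false) then (if d = (i, true) then -1 else 1) else 0)
    + (if c = (i, false) then (if d = (j, true) then -2 else 0) else 0)

theorem headSpec_singleton (d : ι × Bool) :
    HeadSpec (i := i) (j := j) d (image hij []) (image hij [d]) := by
  have h0 := image_nil hij
  unfold HeadSpec
  obtain ⟨d, e⟩ := d
  by_cases hd : d = j
  · subst hd
    cases e
    · rw [image_cons_false hij (by simp [h0])]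
      simp [hij.symm]
    · rw [image_cons_true hij (by simp [h0])]
      simp [hij.symm]
  · rw [image_cons_of_ne hij hd (by simp [h0]), h0]
    split_ifs <;> simp_all

/-- Cancellation never reaches beyond one letter: `j⁻¹` prepended to `i` loses `i⁻¹i`, and `i⁻¹`
prepended to `j` loses the `i` of `φ(j) = ij`. An image starts with `j` only when the word starts
with `i⁻¹`, which rules out any further cancellation in a reduced word. The two claims are proved
together because the length depends on the head of the previous image. -/
theorem headSpec_and_length_image {c d : ι × Bool} {L B : List (ι × Bool)}
    (hcd : c ≠ (d.1, !d.2)) (h : HeadSpec (i := i) (j := j) d B (image hij (d :: L))) :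
    HeadSpec (i := i) (j := j) c (image hij (d :: L)) (image hij (c :: d :: L)) ∧
      ((image hij (c :: d :: L)).length : ℤ) =
        (image hij (d :: L)).length + increment i j c d := by
  have hji := hij.symm
  unfold HeadSpec at *
  obtain ⟨c, b⟩ := c
  obtain ⟨d, e⟩ := d
  generalize hA : image hij ((d, e) :: L) = A at *
  unfold increment
  by_cases hc : c = j
  · subst hc
    cases b
    · by_cases hd : (d, e) = (i, true)
      · simp only [hd, if_true] at h
        rw [image_cons_false_of_cons hij (by rw [hA, h.1]) h.2]
        simp_all
      · rw [image_cons_false hij (by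
          rw [hA]
          split_ifs at h <;> first | (rcases h with h | h <;> simp_all) | simp_all), hA]
        split_ifs <;> simp_all; try omega
    · rw [image_cons_true hij (by
          rw [hA]
          split_ifs at h <;> first | (rcases h with h | h <;> simp_all) | simp_all), hA]
      split_ifs <;> simp_all; try omega
  -- The only cancellation caused by a letter other than `j` or `j⁻¹`.
  · by_cases hx : (c, b) = (i, false) ∧ (d, e) = (j, true)
    · simp only [hx.1, hx.2] at *
      simp [hji] at h
      rw [image_cons_of_cons hij (by rw [hA, h])]
      simp_all
    · rw [image_cons_of_ne hij hc, hA]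
      · split_ifs at h ⊢ <;> simp_all
      · rw [hA]; split_ifs at h <;> cases b <;> first | (rcases h with h | h <;> grind) | grind

theorem exists_headSpec_image {d : ι × Bool} {L : List (ι × Bool)} (h : IsReduced (d :: L)) :
    ∃ B, HeadSpec (i := i) (j := j) d B (image hij (d :: L)) := by
  induction L generalizing d with
  | nil => exact ⟨_, headSpec_singleton hij d⟩
  | cons e L ih =>
    have h' : IsReduced (e :: L) := h.infix (List.suffix_cons d _).isInfix
    obtain ⟨B, hB⟩ := ih h'
    exact ⟨_, (headSpec_and_length_image hij ((isReduced_cons_cons_iff h').1 h) hB).1⟩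

theorem length_image_cons {c d : ι × Bool} {L : List (ι × Bool)} (h : IsReduced (d :: L))
    (hcd : c ≠ (d.1, !d.2)) :
    ((image hij (c :: d :: L)).length : ℤ) =
      (image hij (d :: L)).length + increment i j c d := by
  obtain ⟨B, hB⟩ := exists_headSpec_image hij h
  exact (headSpec_and_length_image hij hcd hB).2

theorem length_image_singleton_of_left : (image hij [(i, true)]).length = 1 := by
  rw [image_cons_of_ne hij hij (by simp [image_nil]), image_nil]
  rfl

end Substitution

/-! ### Positive drift of the image length and an exponential estimate -/

section Drift

variable {ι : Type*} [DecidableEq ι]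

/-- The correction of the length of the image by the first letter which makes the expected
increment positive whatever the preceding letter is. -/
noncomputable def letterCorrection (i j : ι) (δ : ℝ) (c : ι × Bool) : ℝ :=
  (if c = (i, true) then -δ else 0) + (if c = (i, false) then δ else 0)
    + (if c = (j, true) then -δ - 1 / 4 else 0) + (if c = (j, false) then δ - 1 / 4 else 0)

variable {i j : ι}

theorem abs_letterCorrection_le (hij : i ≠ j) {δ : ℝ} (h0 : 0 ≤ δ) (h1 : δ ≤ 1 / 2)
    (c : ι × Bool) :
    |letterCorrection i j δ c| ≤ 3 / 4 := by
  have hji := hij.symm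
  unfold letterCorrection
  rw [abs_le]
  split_ifs <;> constructor <;> simp_all <;> linarith

theorem increment_mem (c d : ι × Bool) :
    (-2 : ℝ) ≤ increment i j c d ∧ (increment i j c d : ℝ) ≤ 4 := by
  unfold increment
  split_ifs <;> push_cast <;> constructor <;> linarith

variable [Fintype ι]

/-- The raw excess sums to 0 after `i` and to -1 after `j`, so the drift is positive only once
averaged over several letters. The correction is a coboundary that spreads it out. With this `δ` one
has `q * δ = 1 + δ`: the sum is exactly 1/2 after `i` or `i⁻¹`, `(q - 1) / 4` after `j` or `j⁻¹`,
and 3/2 after any other letter. -/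
theorem sum_increment (hij : i ≠ j) (hι : 1 < Fintype.card ι) (d : ι × Bool) :
    (1 / 2 : ℝ) ≤ ∑ c ∈ Finset.univ.filter (fun c : ι × Bool => c ≠ (d.1, !d.2)),
      ((increment i j c d : ℝ) - 1
        + letterCorrection i j (1 / (2 * Fintype.card ι - 2)) c
        - letterCorrection i j (1 / (2 * Fintype.card ι - 2)) d) := by
  have hji := hij.symm
  have hι' : (2 : ℝ) ≤ Fintype.card ι := by exact_mod_cast hι
  obtain ⟨δ, hδ⟩ : ∃ δ : ℝ, δ = 1 / (2 * Fintype.card ι - 2) := ⟨_, rfl⟩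
  have hq : (2 * Fintype.card ι - 1 : ℝ) * δ = 1 + δ := by
    have : (2 * Fintype.card ι - 2 : ℝ) * δ = 1 := by
      rw [hδ, mul_one_div_cancel (by linarith)]
    linarith
  have hinc : ∀ c, (increment i j c d : ℝ) - 1 = (if c = (j, true) then 1 else 0)
      + (if c = (j, false) then (if d = (i, true) then -1 else 1) else 0)
      + (if c = (i, false) then (if d = (j, true) then -2 else 0) else 0) := by
    intro c
    unfold increment
    push_cast
    ring
  simp only [hinc]
  rw [← hδ, Finset.sum_sub_distrib, Finset.sum_const, nsmul_eq_mul, card_filter_ne,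
    Finset.filter_ne', Finset.sum_erase_eq_sub (Finset.mem_univ _)]
  simp only [letterCorrection, Finset.sum_add_distrib, Finset.sum_ite_eq',
    Finset.mem_univ, if_true]
  obtain ⟨d, e⟩ := d
  by_cases h1 : d = i
  · subst h1
    cases e <;> simp [hij] <;> nlinarith
  · by_cases h2 : d = j
    · subst h2
      cases e <;> simp [hji] <;> nlinarith
    · simp [h1, h2]; nlinarith

/-- Chernoff argument: in `exp (-t * y) ≤ 1 - t * y + 36 * t ^ 2` the linear gain beats the
quadratic error when `t` is small. -/
theorem sum_exp_le {κ : Type*} (s : Finset κ) (y : κ → ℝ) {t : ℝ} (ht : 0 < t)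
    (hy : ∀ k ∈ s, |y k| ≤ 6) (ht6 : t * 6 ≤ 1) (hsum : t * 36 * s.card ≤ ∑ k ∈ s, y k) :
    ∑ k ∈ s, Real.exp (-t * y k) ≤ s.card := by
  have h1 : ∀ k ∈ s, Real.exp (-t * y k) ≤ 1 - t * y k + t ^ 2 * 36 := by
    intro k hk
    have h2 : |-t * y k| ≤ 1 := by
      rw [abs_mul, abs_neg, abs_of_pos ht]
      nlinarith [hy k hk]
    have h3 := (abs_le.1 (Real.abs_exp_sub_one_sub_id_le h2)).2
    have h4 : (y k) ^ 2 ≤ 36 := by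
      have := sq_le_sq' (abs_le.1 (hy k hk)).1 (abs_le.1 (hy k hk)).2
      linarith
    nlinarith [sq_nonneg t, mul_le_mul_of_nonneg_left h4 (sq_nonneg t)]
  refine (Finset.sum_le_sum h1).trans ?_
  rw [Finset.sum_add_distrib, Finset.sum_sub_distrib, ← Finset.mul_sum]
  simp only [Finset.sum_const, nsmul_eq_mul, mul_one]
  nlinarith

/-- A positive proportion of the reduced words have only suffixes whose image is longer by a
definite factor. -/
theorem exists_le_card_prependings (hij : i ≠ j) (hι : 1 < Fintype.card ι) :
    ∃ ε : ℝ, 0 < ε ∧ ε ≤ 1 ∧ ∃ c : ℝ, 0 < c ∧ ∀ n : ℕ,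
      c * (2 * Fintype.card ι - 1 : ℝ) ^ n ≤
        (prependings (fun L => IsReduced L ∧
          (1 + ε) * L.length ≤ (image hij L).length + 4) [(i, true)] n).card := by
  have hι' : (2 : ℝ) ≤ Fintype.card ι := by exact_mod_cast hι
  obtain ⟨q, hq⟩ : ∃ q : ℝ, q = 2 * Fintype.card ι - 1 := ⟨_, rfl⟩
  have hq3 : 3 ≤ q := by linarith
  set δ : ℝ := 1 / (2 * Fintype.card ι - 2) with hδ
  have hδ0 : 0 ≤ δ := one_div_nonneg.2 (by linarith)
  have hδ1 : δ ≤ 1 / 2 := one_div_le_one_div_of_le (by norm_num) (by linarith)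
  -- Of the drift 1/2, the stretching factor `1 + ε` consumes `q * ε = 1/4`; the other 1/4 equals
  -- `36 * t * q`, the second-order error for the `t` below.
  set ε : ℝ := 1 / (4 * q) with hε
  have hε0 : 0 < ε := by positivity
  have hqε : q * ε = 1 / 4 := by rw [hε]; field_simp
  have hε1 : ε ≤ 1 / 4 := by nlinarith
  set t : ℝ := 1 / (144 * q) with ht
  have ht0 : 0 < t := by positivity
  have hqt : t * 36 * q = 1 / 4 := by rw [ht]; field_simp; norm_num
  let h : ι × Bool → ℝ := letterCorrection i j δ
  have hh : ∀ c, |h c| ≤ 3 / 4 := abs_letterCorrection_le hij hδ0 hδ1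
  -- The offset 3 makes `e` positive on the starting word, while the slack 4 exceeds 3 plus the
  -- largest correction 3/4, so that `e ≤ 0` on bad words.
  let e : List (ι × Bool) → ℝ := fun L =>
    (image hij L).length - (1 + ε) * L.length + (L.head?.map h).getD 0 + 3
  let w : List (ι × Bool) → ℝ := fun L => Real.exp (-t * e L)
  have hhead : ∀ L : List (ι × Bool), |(L.head?.map h).getD 0| ≤ 3 / 4 := by
    rintro (_ | ⟨c, L⟩)
    · simp; norm_num
    · simpa using hh c
  have hw₀ : w [(i, true)] < 1 := by
    rw [Real.exp_lt_one_iff]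
    have h1 := (abs_le.1 (hhead [(i, true)])).1
    have h2 : 0 < e [(i, true)] := by
      simp only [e, length_image_singleton_of_left, List.length_singleton, Nat.cast_one]
      linarith
    nlinarith
  refine ⟨ε, hε0, by linarith, 1 - w [(i, true)], by linarith, fun n => ?_⟩
  rw [mul_comm]
  refine le_card_prependings w ?_ ?_ _ (fun L => (Real.exp_pos _).le) n
  · intro L hL
    rw [not_le] at hL
    refine Real.one_le_exp ?_
    have h1 := (abs_le.1 (hhead L)).2
    have h2 : e L ≤ 0 := by simp only [e]; linarith
    nlinarith
  · intro d L hr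
    have key : ∀ c ∈ Finset.univ.filter (fun c : ι × Bool => c ≠ (d.1, !d.2)),
        w (c :: d :: L) =
          Real.exp (-t * ((increment i j c d : ℝ) - 1 + h c - h d - ε)) * w (d :: L) := by
      intro c hc
      have h1 : ((image hij (c :: d :: L)).length : ℝ) =
          (image hij (d :: L)).length + increment i j c d := by
        exact_mod_cast length_image_cons hij hr (Finset.mem_filter.1 hc).2
      simp only [w, ← Real.exp_add, e, h1]
      congr 1
      simp
      ring
    rw [Finset.sum_congr rfl key, ← Finset.sum_mul, ← card_filter_ne (d.1, !d.2)]
    refine mul_le_mul_of_nonneg_right (sum_exp_le _ _ ht0 ?_ ?_ ?_) (Real.exp_pos _).le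
    · intro c _
      have h1 := increment_mem (i := i) (j := j) c d
      have h2 := abs_le.1 (hh c)
      have h3 := abs_le.1 (hh d)
      rw [abs_le]
      constructor <;> linarith [h1.1, h1.2, h2.1, h2.2, h3.1, h3.2]
    · nlinarith
    · rw [Finset.sum_sub_distrib, Finset.sum_const, nsmul_eq_mul, card_filter_ne, ← hq, hqt,
        hqε]
      linarith [sum_increment hij hι d]

end Drift

/-! ### The action on a pruned Cayley tree -/

section TreeAction

theorem mk_mul_mk_not {ι : Type*} (c : ι × Bool) :
    (mk [c] * mk [(c.1, !c.2)] : FreeGroup ι) = 1 := by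
  obtain ⟨c, b⟩ := c
  have : (mk [(c, !b)] : FreeGroup ι) = (mk [(c, b)])⁻¹ := by simp [invRev]
  rw [this, mul_inv_cancel]

/-- A word is admissible for `G` if it changes its generator only at elements of `G`, when it is
read from the right to the left. -/
def Admissible {ι : Type*} (G : Set (FreeGroup ι)) : List (ι × Bool) → Prop
  | [] => True
  | c :: L => Admissible G L ∧ (L.head?.map Prod.fst = some c.1 ∨ mk L ∈ G)

theorem admissible_of_forall_suffix {ι : Type*} {G : Set (FreeGroup ι)}
    {L : List (ι × Bool)} (h : ∀ L', L' <:+ L → mk L' ∈ G) :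
    Admissible G L := by
  induction L with
  | nil => trivial
  | cons c L ih =>
    exact ⟨ih fun L' hL' => h L' (hL'.trans (List.suffix_cons c L)),
      Or.inr (h L (List.suffix_cons c L))⟩

/-- Going back from the last letter to the most recent point of `G`, the generator never changes,
and reducedness also fixes its sign. -/
theorem Admissible.exists_eq_replicate_append {ι : Type*} {G : Set (FreeGroup ι)}
    {L : List (ι × Bool)} (hr : IsReduced L) (hL : Admissible G L) (h0 : L ≠ []) :
    ∃ d m u, L = List.replicate (m + 1) d ++ u ∧ mk u ∈ G := by
  induction L with
  | nil => exact absurd rfl h0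
  | cons c L ih =>
    obtain ⟨hL1, h | h⟩ := hL
    · have hL0 : L ≠ [] := by rintro rfl; simp at h
      obtain ⟨d, m, u, rfl, hu⟩ := ih (hr.infix (List.suffix_cons c L).isInfix) hL1 hL0
      refine ⟨d, m + 1, u, ?_, hu⟩
      rw [List.replicate_succ, List.cons_append, isReduced_cons_cons] at hr
      have h1 : c.1 = d.1 := by simpa [List.replicate_succ] using h.symm
      rw [show c = d from Prod.ext h1 (hr.1 h1), List.replicate_succ (n := m + 1), List.cons_append]
    · exact ⟨c, 0, L, by simp, h⟩

variable {ι : Type*} [DecidableEq ι]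

/-- The elements of the free group whose reduced words are admissible. -/
@[ext]
structure AdmissibleSet (G : Set (FreeGroup ι)) where
  /-- The underlying element of the free group. -/
  val : FreeGroup ι
  /-- The reduced word is admissible. -/
  property : Admissible G val.toWord

variable {G : Set (FreeGroup ι)}

/-- The criterion sees only the generator of `c`, not its sign. Therefore a letter and its inverse
are blocked at the same points, which makes `move` a permutation. -/
theorem admissible_mk_mul_iff {q : FreeGroup ι} (hq : Admissible G q.toWord) (c : ι × Bool) :
    Admissible G (mk [c] * q).toWord ↔ (q.toWord.head?.map Prod.fst = some c.1 ∨ q ∈ G) := by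
  rw [toWord_mk_singleton_mul]
  split_ifs with h
  · have h1 : Admissible G q.toWord.tail := by
      revert hq
      cases q.toWord with
      | nil => exact id
      | cons d L => exact fun h => h.1
    simp [h1, h]
  · simp only [Admissible, hq, true_and, mk_toWord]

open Classical in
/-- The partially defined left multiplication by a letter, extended by the identity. -/
noncomputable def move (c : ι × Bool) (q : AdmissibleSet G) : AdmissibleSet G :=
  if h : Admissible G (mk [c] * q.val).toWord then ⟨_, h⟩ else q

theorem val_move_of_admissible {c : ι × Bool} {q : AdmissibleSet G}
    (h : Admissible G (mk [c] * q.val).toWord) : (move c q).val = mk [c] * q.val := by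
  rw [move, dif_pos h]

theorem move_of_not_admissible {c : ι × Bool} {q : AdmissibleSet G}
    (h : ¬Admissible G (mk [c] * q.val).toWord) : move c q = q := by
  rw [move, dif_neg h]

theorem move_move (c : ι × Bool) (q : AdmissibleSet G) : move c (move (c.1, !c.2) q) = q := by
  have hiff : Admissible G (mk [c] * q.val).toWord ↔
      Admissible G (mk [(c.1, !c.2)] * q.val).toWord := by
    rw [admissible_mk_mul_iff q.property, admissible_mk_mul_iff q.property]
  by_cases h : Admissible G (mk [(c.1, !c.2)] * q.val).toWord
  · have h1 := val_move_of_admissible h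
    have h2 : mk [c] * (move (c.1, !c.2) q).val = q.val := by
      rw [h1, ← mul_assoc, mk_mul_mk_not, one_mul]
    ext
    rw [val_move_of_admissible, h2]
    rw [h2]
    exact q.property
  · rw [move_of_not_admissible h, move_of_not_admissible (mt hiff.1 h)]

/-- The left action of the free group on the admissible elements. -/
noncomputable def leftAction (G : Set (FreeGroup ι)) :
    FreeGroup ι →* Equiv.Perm (AdmissibleSet G) :=
  FreeGroup.lift fun k =>
    ⟨move (k, true), move (k, false), move_move (k, false), move_move (k, true)⟩

theorem leftAction_mk_singleton (c : ι × Bool) (q : AdmissibleSet G) :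
    leftAction G (mk [c]) q = move c q := by
  obtain ⟨k, b⟩ := c
  cases b
  · have : (mk [(k, false)] : FreeGroup ι) = (FreeGroup.of k)⁻¹ := by
      simp [FreeGroup.of, invRev]
    rw [this, _root_.map_inv, leftAction, lift_apply_of]
    rfl
  · change leftAction G (FreeGroup.of k) q = _
    rw [leftAction, lift_apply_of]
    rfl

noncomputable instance : MulAction (FreeGroup ι)ᵐᵒᵖ (AdmissibleSet G) where
  smul g s := leftAction G g.unop⁻¹ s
  one_smul s := by
    change leftAction G (1 : FreeGroup ι)⁻¹ s = s
    rw [inv_one, _root_.map_one, Equiv.Perm.one_apply]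
  mul_smul g h s := by
    change leftAction G (h.unop * g.unop)⁻¹ s = leftAction G g.unop⁻¹ (leftAction G h.unop⁻¹ s)
    rw [mul_inv_rev, _root_.map_mul, Equiv.Perm.mul_apply]

theorem op_smul_eq (g : FreeGroup ι) (s : AdmissibleSet G) :
    op g • s = leftAction G g⁻¹ s := rfl

/-- The identity as an admissible element. -/
def AdmissibleSet.base (G : Set (FreeGroup ι)) : AdmissibleSet G := ⟨1, by simp [Admissible]⟩

theorem val_leftAction_base (L : List (ι × Bool)) (hr : IsReduced L) (hL : Admissible G L) :
    (leftAction G (mk L) (AdmissibleSet.base G)).val = mk L := by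
  induction L with
  | nil =>
    rw [← one_eq_mk, _root_.map_one, Equiv.Perm.one_apply]
    rfl
  | cons c L ih =>
    have h1 := ih (hr.infix (List.suffix_cons c L).isInfix) hL.1
    rw [mk_cons, _root_.map_mul, Equiv.Perm.mul_apply, leftAction_mk_singleton,
      val_move_of_admissible, h1]
    rwa [h1, ← mk_cons, toWord_mk, hr.reduce_eq]

theorem leftAction_base (q : AdmissibleSet G) :
    leftAction G q.val (AdmissibleSet.base G) = q := by
  have h1 := val_leftAction_base q.val.toWord isReduced_toWord q.property
  rw [mk_toWord] at h1
  exact AdmissibleSet.ext h1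

instance : MulAction.IsPretransitive (FreeGroup ι)ᵐᵒᵖ (AdmissibleSet G) where
  exists_smul_eq x y := by
    refine ⟨op (x.val * y.val⁻¹), ?_⟩
    rw [op_smul_eq, mul_inv_rev, inv_inv, _root_.map_mul, Equiv.Perm.mul_apply, _root_.map_inv,
      Equiv.Perm.inv_eq_iff_eq.2 (leftAction_base x).symm, leftAction_base]

theorem norm_move_le (c : ι × Bool) (q : AdmissibleSet G) :
    (move c q).val.norm ≤ q.val.norm + 1 := by
  by_cases h : Admissible G (mk [c] * q.val).toWord
  · rw [val_move_of_admissible h]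
    refine (FreeGroup.norm_mul_le _ _).trans ?_
    rw [add_comm]
    exact Nat.add_le_add_left norm_mk_le _
  · rw [move_of_not_admissible h]
    omega

theorem norm_leftAction_le (g : FreeGroup ι) (q : AdmissibleSet G) :
    (leftAction G g q).1.norm ≤ q.val.norm + g.norm := by
  suffices h : ∀ L : List (ι × Bool),
      (leftAction G (mk L) q).1.norm ≤ q.val.norm + L.length by
    have h1 := h g.toWord
    rwa [mk_toWord] at h1
  intro L
  induction L with
  | nil => simp [← one_eq_mk]
  | cons c L ih =>
    rw [mk_cons, _root_.map_mul, Equiv.Perm.mul_apply, leftAction_mk_singleton, List.length_cons]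
    exact (norm_move_le _ _).trans (by omega)

theorem val_injective : Function.Injective (AdmissibleSet.val : AdmissibleSet G → FreeGroup ι) :=
  fun _ _ => AdmissibleSet.ext

variable [Fintype ι]

theorem finite_admissible_norm_le (n : ℕ) : {s : AdmissibleSet G | s.val.norm ≤ n}.Finite :=
  Set.Finite.of_finite_image ((finite_norm_le n).subset (by rintro _ ⟨s, hs, rfl⟩; exact hs))
    val_injective.injOn

/-- Every admissible element has the form `d ^ m * u` with `d` a letter, `m ≤ n` and `u ∈ G` no
longer than `n`; the identity uses `m = 0` and `1 ∈ G`. -/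
theorem ncard_admissible_norm_le [Nonempty ι] (hG : 1 ∈ G) (n : ℕ) :
    {s : AdmissibleSet G | s.val.norm ≤ n}.ncard ≤
      2 * Fintype.card ι * (n + 1) * {u : FreeGroup ι | u ∈ G ∧ u.norm ≤ n}.ncard := by
  classical
  have hfin : {u : FreeGroup ι | u ∈ G ∧ u.norm ≤ n}.Finite :=
    (finite_norm_le n).subset fun u hu => hu.2
  let f : (ι × Bool) × ℕ × FreeGroup ι → FreeGroup ι := fun p =>
    mk (List.replicate p.2.1 p.1) * p.2.2
  let s : Finset ((ι × Bool) × ℕ × FreeGroup ι) :=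
    Finset.univ ×ˢ Finset.range (n + 1) ×ˢ hfin.toFinset
  have hsub : AdmissibleSet.val '' {s : AdmissibleSet G | s.val.norm ≤ n} ⊆
      (s.image f : Finset _) := by
    rintro _ ⟨q, hq, rfl⟩
    simp only [Finset.coe_image, Set.mem_image, Finset.mem_coe, s, Finset.mem_product,
      Finset.mem_univ, true_and, Finset.mem_range, Set.Finite.mem_toFinset, Set.mem_ofPred_eq, f,
      Prod.exists]
    rcases eq_or_ne q.val.toWord [] with h0 | h0
    · exact ⟨Classical.arbitrary ι, true, 0, 1, ⟨by omega, hG, by simp⟩, by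
        rw [toWord_eq_nil_iff.1 h0]; simp [← one_eq_mk]⟩
    · obtain ⟨d, m, u, h1, hu⟩ := q.property.exists_eq_replicate_append isReduced_toWord h0
      have h2 : m + 1 + u.length ≤ n := by
        have : q.val.toWord.length ≤ n := hq
        simpa [h1] using this
      refine ⟨d.1, d.2, m + 1, mk u, ⟨by omega, hu, norm_mk_le.trans (by omega)⟩, ?_⟩
      rw [mul_mk, ← h1, mk_toWord]
  calc _ = (AdmissibleSet.val '' {s : AdmissibleSet G | s.val.norm ≤ n}).ncard :=
        (Set.ncard_image_of_injective _ val_injective).symm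
    _ ≤ (s.image f).card := by
        rw [← Set.ncard_coe_finset]
        exact Set.ncard_le_ncard hsub (Finset.finite_toSet _)
    _ ≤ s.card := Finset.card_image_le
    _ = _ := by
        rw [Finset.card_product, Finset.card_product, Finset.card_univ, Fintype.card_prod,
          Fintype.card_bool, Finset.card_range, ← Set.ncard_eq_toFinset_card _ hfin]
        ring

end TreeAction

/-! ### Good words trace paths inside the stretched set -/

section Reachable

variable {ι : Type*} [DecidableEq ι]

/-- All suffixes of the reduced word of `q` lie in `G`, and `q` is the image of the identity under
its own left action. -/
def Reachable (G : Set (FreeGroup ι)) (q : FreeGroup ι) : Prop :=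
  (∀ L, L <:+ q.toWord → mk L ∈ G) ∧ (leftAction G q (AdmissibleSet.base G)).val = q

variable {G : Set (FreeGroup ι)}

theorem reachable_one (hG : 1 ∈ G) : Reachable G 1 := by
  refine ⟨fun L hL => ?_, ?_⟩
  · obtain rfl : L = [] := by simpa using hL
    rwa [← one_eq_mk]
  · rw [_root_.map_one, Equiv.Perm.one_apply]
    rfl

/-- Prepending a letter either cancels, leaving a suffix of the old word, or creates a single new
suffix, `c * q` itself. So the new word is admissible and the move is not blocked. -/
theorem Reachable.mk_mul {q : FreeGroup ι} (hq : Reachable G q) {c : ι × Bool}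
    (hc : mk [c] * q ∈ G) : Reachable G (mk [c] * q) := by
  have h1 : ∀ L, L <:+ (mk [c] * q).toWord → mk L ∈ G := by
    intro L hL
    rw [toWord_mk_singleton_mul] at hL
    split_ifs at hL with h
    · exact hq.1 L (hL.trans (List.tail_suffix _))
    · rcases List.suffix_cons_iff.1 hL with rfl | hL
      · rwa [mk_cons, mk_toWord]
      · exact hq.1 L hL
  refine ⟨h1, ?_⟩
  rw [_root_.map_mul, Equiv.Perm.mul_apply, leftAction_mk_singleton,
    val_move_of_admissible, hq.2]
  rw [hq.2]
  exact admissible_of_forall_suffix h1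

variable {i j : ι} (hij : i ≠ j)

/-- The elements whose length in the basis `nielsen i j` is, up to a constant, shorter by a definite
factor. -/
def stretched (hij : i ≠ j) (ε : ℝ) : Set (FreeGroup ι) :=
  {p | (1 + ε) * ((nielsen i j hij).symm p).norm ≤ p.norm + (7 + 2 * ε)}

theorem one_mem_stretched {ε : ℝ} (hε : 0 ≤ ε) : 1 ∈ stretched hij ε := by
  simp only [stretched, Set.mem_ofPred_eq, _root_.map_one, FreeGroup.norm_one]
  norm_num
  linarith

/-- Going from an element to a neighbour of a stretched one. -/
theorem mk_mul_nielsen_mem_stretched {ε : ℝ} (hε : 0 ≤ ε) {L : List (ι × Bool)}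
    (hL : (1 + ε) * L.length ≤ (image hij L).length + 4) {c : ι × Bool}
    {v : FreeGroup ι} (hv : v.norm ≤ 2) (hcv : nielsen i j hij v = mk [c]) :
    mk [c] * nielsen i j hij (mk L) ∈ stretched hij ε := by
  rw [stretched, Set.mem_ofPred_eq, ← hcv, ← _root_.map_mul, MulEquiv.symm_apply_apply]
  have h1 : (v * mk L).norm ≤ 2 + L.length :=
    (FreeGroup.norm_mul_le _ _).trans (add_le_add hv norm_mk_le)
  have h2 : (image hij L).length ≤ (nielsen i j hij (v * mk L)).norm + 1 := by
    have h3 : nielsen i j hij (mk L) = (mk [c])⁻¹ * nielsen i j hij (v * mk L) := by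
      rw [_root_.map_mul, hcv, inv_mul_cancel_left]
    change (nielsen i j hij (mk L)).norm ≤ _
    rw [h3]
    refine (FreeGroup.norm_mul_le _ _).trans ?_
    rw [norm_inv_eq, add_comm]
    exact Nat.add_le_add_left norm_mk_le _
  have h1' : ((v * mk L).norm : ℝ) ≤ 2 + L.length := by exact_mod_cast h1
  have h2' : ((image hij L).length : ℝ) ≤ (nielsen i j hij (v * mk L)).norm + 1 := by
    exact_mod_cast h2
  -- The slack `7 + 2 * ε` arises here: `4` from the word, `2 * (1 + ε)` from `v`, and `1` from the
  -- letter `c`.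
  nlinarith

theorem nielsen_mk_mem_stretched {ε : ℝ} (hε : 0 ≤ ε) {L : List (ι × Bool)}
    (hL : (1 + ε) * L.length ≤ (image hij L).length + 4) :
    nielsen i j hij (mk L) ∈ stretched hij ε := by
  rw [stretched, Set.mem_ofPred_eq, MulEquiv.symm_apply_apply]
  have h1 : ((mk L).norm : ℝ) ≤ L.length := by exact_mod_cast norm_mk_le
  have h2 : ((nielsen i j hij (mk L)).norm : ℝ) = (image hij L).length := rfl
  rw [h2]
  nlinarith

theorem reachable_nielsen_cons {ε : ℝ} (hε : 0 ≤ ε) {L : List (ι × Bool)}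
    (hr : Reachable (stretched hij ε) (nielsen i j hij (mk L)))
    (hL : (1 + ε) * L.length ≤ (image hij L).length + 4) {c : ι × Bool}
    (hc : (1 + ε) * (c :: L).length ≤ (image hij (c :: L)).length + 4) :
    Reachable (stretched hij ε) (nielsen i j hij (mk (c :: L))) := by
  have hmem := nielsen_mk_mem_stretched hij hε hc
  rw [mk_cons, _root_.map_mul] at hmem ⊢
  by_cases hcj : c.1 = j
  · obtain ⟨k, b⟩ := c
    obtain rfl : k = j := hcj
    cases b
    -- Since `φ(j⁻¹) = j⁻¹i⁻¹` takes two steps in the tree, the midpoint `i⁻¹p = φ(i⁻¹)p` must lie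
    -- in `G` as well.
    · rw [nielsen_mk_false, mul_assoc] at hmem ⊢
      refine Reachable.mk_mul (hr.mk_mul ?_) hmem
      exact mk_mul_nielsen_mem_stretched hij hε hL (v := mk [(i, false)])
        (norm_mk_le.trans (by simp)) (nielsen_mk_of_ne hij hij)
    -- Here the midpoint is `jp`, and `j = φ(i⁻¹j)` is the image of an element of length 2.
    · rw [nielsen_mk_true, mul_assoc] at hmem ⊢
      refine Reachable.mk_mul (hr.mk_mul ?_) hmem
      refine mk_mul_nielsen_mem_stretched hij hε hL (v := mk [(i, false), (k, true)])
        (norm_mk_le.trans (by simp)) ?_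
      rw [mk_cons, _root_.map_mul, nielsen_mk_of_ne hij hij, nielsen_mk_true, ← mul_assoc,
        show mk [(i, false)] * mk [(i, true)] = 1 from mk_mul_mk_not (i, false), one_mul]
  · rw [nielsen_mk_of_ne hij hcj] at hmem ⊢
    exact hr.mk_mul hmem

theorem reachable_of_mem_prependings [Fintype ι] {ε : ℝ} (hε : 0 ≤ ε) (hε1 : ε ≤ 1) {n : ℕ}
    {L : List (ι × Bool)}
    (hL : L ∈ prependings (fun L => IsReduced L ∧
      (1 + ε) * L.length ≤ (image hij L).length + 4) [(i, true)] n) :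
    Reachable (stretched hij ε) (nielsen i j hij (mk L)) ∧ IsReduced L ∧ L.length = n + 1 ∧
      (1 + ε) * L.length ≤ (image hij L).length + 4 := by
  induction n generalizing L with
  | zero =>
    obtain rfl : L = [(i, true)] := by simpa [prependings] using hL
    have h1 : (1 + ε) * ([(i, true)] : List (ι × Bool)).length ≤
        (image hij [(i, true)]).length + 4 := by
      rw [length_image_singleton_of_left]
      simp
      linarith
    refine ⟨reachable_nielsen_cons hij hε ?_ ?_ h1, by simp, by simp, h1⟩
    · rw [← one_eq_mk, _root_.map_one]
      exact reachable_one (one_mem_stretched hij hε)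
    · simp [image_nil]
  | succ n ih =>
    obtain ⟨⟨hr, hg⟩, c, L', hL', rfl⟩ := mem_prependings_succ.1 hL
    obtain ⟨h1, -, h3, h4⟩ := ih hL'
    exact ⟨reachable_nielsen_cons hij hε h1 h4 hg, hr, by simp [h3], hg⟩

end Reachable

/-! ### Criteria for maximal and non-maximal growth -/

section MaximalGrowth

variable {ι F : Type*} [DecidableEq ι] [Group F] (b : FreeGroupBasis ι F)

theorem ncard_filtration (n : ℕ) :
    (filtration b n).ncard = {g : FreeGroup ι | g.norm ≤ n}.ncard := by
  have h : b.repr '' filtration b n = {g : FreeGroup ι | g.norm ≤ n} := by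
    ext g
    constructor
    · rintro ⟨x, hx, rfl⟩
      exact hx
    · intro hg
      exact ⟨b.repr.symm g, by simpa [filtration] using hg, by simp⟩
  rw [← h, Set.ncard_image_of_injective _ b.repr.injective]

theorem growthFunction_regular (n : ℕ) :
    growthFunction b ({1} : Set F) n = {g : FreeGroup ι | g.norm ≤ n}.ncard := by
  rw [← ncard_filtration b, growthFunction]
  congr 1
  ext g
  simp [ball]

variable [Fintype ι]

theorem finite_filtration (n : ℕ) : (filtration b n).Finite :=
  (finite_norm_le n).preimage b.repr.injective.injOn

variable {S : Type*} [MulAction Fᵐᵒᵖ S]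

theorem growthFunction_singleton_le (s : S) (n : ℕ) :
    growthFunction b {s} n ≤ {g : FreeGroup ι | g.norm ≤ n}.ncard := by
  rw [← ncard_filtration b]
  have h : ball b {s} n ⊆ (fun g : F => op g • s) '' filtration b n := by
    rintro _ ⟨_, rfl, g, hg, rfl⟩
    exact ⟨g, hg, rfl⟩
  exact (Set.ncard_le_ncard h ((finite_filtration b n).image _)).trans
    (Set.ncard_image_le (finite_filtration b n))

theorem growthFunction_le_card_mul {A : Set S} (hA : A.Finite) (n : ℕ) :
    growthFunction b A n ≤ A.ncard * {g : FreeGroup ι | g.norm ≤ n}.ncard := by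
  rw [← ncard_filtration b]
  have h : ball b A n ⊆ (fun p : S × F => op p.2 • p.1) '' (A ×ˢ filtration b n) := by
    rintro _ ⟨a, ha, g, hg, rfl⟩
    exact ⟨(a, g), ⟨ha, hg⟩, rfl⟩
  have hfin : (A ×ˢ filtration b n).Finite := hA.prod (finite_filtration b n)
  refine (Set.ncard_le_ncard h (hfin.image _)).trans ((Set.ncard_image_le hfin).trans ?_)
  rw [Set.ncard_prod]

theorem exists_growthFunction_singleton_le (s : S) {A : Set S} (hA : A.Finite)
    (hgen : IsGeneratingSet F A) :
    ∃ D, ∀ n, growthFunction b {s} n ≤ growthFunction b A (n + D) := by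
  obtain ⟨a, ha, g, hg⟩ := hgen s
  refine ⟨(b.repr g).norm, fun n => Set.ncard_le_ncard ?_ (ball_finite b hA _)⟩
  rintro _ ⟨_, rfl, h, hh, rfl⟩
  refine ⟨a, ha, g * h, ?_, by rw [op_mul, mul_smul, hg]⟩
  have h1 : (b.repr h).norm ≤ n := hh
  change (b.repr (g * h)).norm ≤ _
  rw [_root_.map_mul]
  refine (FreeGroup.norm_mul_le _ _).trans ?_
  omega

/-- All balls in question have at most a constant times `q ^ n` elements, and a constant factor is
absorbed by a shift because `q > 1`. -/
theorem hasMaximalGrowth_of_le [MulAction.IsPretransitive Fᵐᵒᵖ S] (hι : 1 < Fintype.card ι) (s : S)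
    {c : ℝ} (hc : 0 < c)
    (h : ∀ n : ℕ, c * (2 * Fintype.card ι - 1 : ℝ) ^ n ≤ growthFunction b {s} n) :
    HasMaximalGrowth b S := by
  have hι' : (2 : ℝ) ≤ Fintype.card ι := by exact_mod_cast hι
  have hq1 : (1 : ℝ) < 2 * Fintype.card ι - 1 := by linarith
  have hq0 : ∀ n : ℕ, (0 : ℝ) < (2 * Fintype.card ι - 1) ^ n := fun n =>
    pow_pos (by linarith) n
  have compare : ∀ k : ℝ, ∃ C : ℕ, ∀ n : ℕ,
      k * (3 * (2 * Fintype.card ι - 1 : ℝ) ^ n) ≤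
        c * (2 * Fintype.card ι - 1 : ℝ) ^ (n + C) := by
    intro k
    obtain ⟨C, hC⟩ := pow_unbounded_of_one_lt (k * 3 / c) hq1
    refine ⟨C, fun n => ?_⟩
    rw [div_lt_iff₀ hc] at hC
    rw [pow_add]
    nlinarith [hq0 n]
  refine ⟨⟨{s}, Set.finite_singleton s, fun t => ?_⟩, fun A hA hgen => ⟨?_, ?_⟩⟩
  · obtain ⟨g, hg⟩ := MulAction.exists_smul_eq Fᵐᵒᵖ s t
    exact ⟨s, rfl, g.unop, hg⟩
  · obtain ⟨C, hC⟩ := compare A.ncard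
    refine ⟨C, fun n => ?_⟩
    have h1 : (growthFunction b A n : ℝ) ≤ A.ncard * {g : FreeGroup ι | g.norm ≤ n}.ncard := by
      exact_mod_cast growthFunction_le_card_mul b hA n
    have h2 : (growthFunction b {s} (n + C) : ℝ) ≤ growthFunction b ({1} : Set F) (n + C) := by
      rw [growthFunction_regular]
      exact_mod_cast growthFunction_singleton_le b s (n + C)
    have h3 := mul_le_mul_of_nonneg_left (ncard_norm_le (ι := ι) hι n)
      (Nat.cast_nonneg A.ncard : (0 : ℝ) ≤ _)
    exact_mod_cast h1.trans (h3.trans ((hC n).trans ((h (n + C)).trans h2)))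
  · obtain ⟨C, hC⟩ := compare 1
    obtain ⟨D, hD⟩ := exists_growthFunction_singleton_le b s hA hgen
    refine ⟨C + D, fun n => ?_⟩
    have h1 : (growthFunction b ({1} : Set F) n : ℝ) ≤
        3 * (2 * Fintype.card ι - 1 : ℝ) ^ n := by
      rw [growthFunction_regular]
      exact ncard_norm_le hι n
    have h2 : growthFunction b ({1} : Set F) n ≤ growthFunction b {s} (n + C) := by
      have := hC n
      rw [one_mul] at this
      exact_mod_cast h1.trans (this.trans (h (n + C)))
    rw [← add_assoc]
    exact h2.trans (hD _)

theorem not_hasMaximalGrowth_of_le {A : Set S} (hA : A.Finite) (hgen : IsGeneratingSet F A)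
    {c : ℝ} (hc : 0 < c)
    (hreg : ∀ n : ℕ, c * (2 * Fintype.card ι - 1 : ℝ) ^ n ≤
      {g : FreeGroup ι | g.norm ≤ n}.ncard)
    {σ : ℝ} (hσ : 0 < σ) (hσq : σ < 2 * Fintype.card ι - 1)
    {N : ℕ} (hN : ∀ n : ℕ, N ≤ n → (growthFunction b A n : ℝ) ≤ σ ^ n) :
    ¬ HasMaximalGrowth b S := by
  rintro ⟨-, h⟩
  obtain ⟨C, hC⟩ := (h A hA hgen).2
  have hq0 : (0 : ℝ) < 2 * Fintype.card ι - 1 := hσ.trans hσq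
  have hlim := (tendsto_pow_atTop_nhds_zero_of_lt_one (div_pos hσ hq0).le
    ((div_lt_one hq0).2 hσq)).eventually_lt_const (div_pos hc (pow_pos hσ C))
  obtain ⟨n, hn, hnN⟩ := (hlim.and (Filter.eventually_ge_atTop N)).exists
  have h1 : c * (2 * Fintype.card ι - 1 : ℝ) ^ n ≤ σ ^ (n + C) := by
    refine (hreg n).trans ((Nat.cast_le.2 ?_).trans (hN (n + C) (by omega)))
    rw [← growthFunction_regular b]
    exact hC n
  rw [div_pow, div_lt_div_iff₀ (pow_pos hq0 n) (pow_pos hσ C), ← pow_add] at hn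
  linarith

end MaximalGrowth

/-! ### Twisting an action by an automorphism -/

section Twist

variable {F : Type*} [Group F]

/-- The right `F`-set with the same elements as `S`, on which `g` acts as `φ g` does on `S`. -/
def Twist (_ : F ≃* F) (S : Type*) : Type _ := S

variable (φ : F ≃* F) {S : Type*} [MulAction Fᵐᵒᵖ S]

/-- The identity from the twisted set to the original one. -/
def untwist : Twist φ S ≃ S := Equiv.refl _

instance : MulAction Fᵐᵒᵖ (Twist φ S) where
  smul g x := (untwist φ).symm (op (φ g.unop) • untwist φ x)
  one_smul x := by
    change (untwist φ).symm (op (φ (1 : F)) • untwist φ x) = x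
    rw [_root_.map_one, op_one, one_smul, Equiv.symm_apply_apply]
  mul_smul g h x := by
    change (untwist φ).symm (op (φ (h.unop * g.unop)) • untwist φ x) =
      (untwist φ).symm (op (φ g.unop) •
        untwist φ ((untwist φ).symm (op (φ h.unop) • untwist φ x)))
    rw [Equiv.apply_symm_apply, _root_.map_mul, op_mul, mul_smul]

theorem untwist_op_smul (x : Twist φ S) (g : F) :
    untwist φ (op g • x) = op (φ g) • untwist φ x := rfl

instance [MulAction.IsPretransitive Fᵐᵒᵖ S] : MulAction.IsPretransitive Fᵐᵒᵖ (Twist φ S) where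
  exists_smul_eq x y := by
    obtain ⟨g, hg⟩ := MulAction.exists_smul_eq Fᵐᵒᵖ (untwist φ x) (untwist φ y)
    refine ⟨op (φ.symm g.unop), (untwist φ).injective ?_⟩
    rw [untwist_op_smul, MulEquiv.apply_symm_apply, op_unop, hg]

theorem growthFunction_twist {ι : Type*} [DecidableEq ι] (b : FreeGroupBasis ι F) (A : Set S)
    (n : ℕ) :
    growthFunction b (untwist φ ⁻¹' A) n = growthFunction (b.map φ) A n := by
  have h : untwist φ '' ball b (untwist φ ⁻¹' A) n = ball (b.map φ) A n := by
    ext s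
    constructor
    · rintro ⟨_, ⟨a, ha, g, hg, rfl⟩, rfl⟩
      refine ⟨untwist φ a, ha, φ g, ?_, rfl⟩
      change (b.repr (φ.symm (φ g))).norm ≤ n
      rwa [MulEquiv.symm_apply_apply]
    · rintro ⟨a, ha, g, hg, rfl⟩
      refine ⟨_, ⟨(untwist φ).symm a, by simpa using ha, φ.symm g, hg, rfl⟩, ?_⟩
      rw [untwist_op_smul, MulEquiv.apply_symm_apply, Equiv.apply_symm_apply]
  rw [growthFunction, growthFunction, ← h,
    Set.ncard_image_of_injective _ (untwist φ).injective]

end Twist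

/-! ### Growth of the constructed set in both bases -/

section Stretched

theorem eventually_linear_mul_pow_le (K D : ℝ) {τ σ : ℝ} (hτ : 0 < τ) (h : τ < σ) :
    ∀ᶠ n : ℕ in Filter.atTop, K * (n + D) * τ ^ n ≤ σ ^ n := by
  have hσ : 0 < σ := hτ.trans h
  have h0 : 0 ≤ τ / σ := (div_pos hτ hσ).le
  have h1 : τ / σ < 1 := (div_lt_one hσ).2 h
  have hlim := ((tendsto_self_mul_const_pow_of_lt_one h0 h1).const_mul K).add
    ((tendsto_pow_atTop_nhds_zero_of_lt_one h0 h1).const_mul (K * D))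
  rw [mul_zero, mul_zero, add_zero] at hlim
  filter_upwards [hlim.eventually_le_const zero_lt_one] with n hn
  rw [div_pow] at hn
  have h2 : K * (n + D) * τ ^ n =
      (K * (n * (τ ^ n / σ ^ n)) + K * D * (τ ^ n / σ ^ n)) * σ ^ n := by
    field_simp
  rw [h2]
  exact mul_le_of_le_one_left (pow_pos hσ n).le hn

variable {ι : Type*} [DecidableEq ι]

theorem exists_norm_le_of_finite {G : Set (FreeGroup ι)} {A : Set (AdmissibleSet G)}
    (hA : A.Finite) : ∃ D : ℕ, ∀ n, ball (FreeGroupBasis.ofFreeGroup ι) A n ⊆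
      {s | s.val.norm ≤ n + D} := by
  obtain ⟨D, hD⟩ := (hA.image fun s => s.val.norm).bddAbove
  refine ⟨D, fun n => ?_⟩
  rintro _ ⟨a, ha, g, hg, rfl⟩
  have h1 : a.val.norm ≤ D := hD ⟨a, ha, rfl⟩
  have h2 : g.norm ≤ n := hg
  have h3 := norm_leftAction_le g⁻¹ a
  rw [norm_inv_eq] at h3
  change (leftAction G g⁻¹ a).val.norm ≤ _
  omega

variable [Fintype ι] {i j : ι} (hij : i ≠ j)

/-- The point reached from the base by `φ(L)` is `φ(L)` itself, so distinct reduced words reach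
distinct points. The radius is `n + 1` because the starting word already has one letter. -/
theorem card_prependings_le_growthFunction {ε : ℝ} (hε : 0 ≤ ε) (hε1 : ε ≤ 1) (n : ℕ) :
    (prependings (fun L => IsReduced L ∧
      (1 + ε) * L.length ≤ (image hij L).length + 4) [(i, true)] n).card ≤
      growthFunction ((FreeGroupBasis.ofFreeGroup ι).map (nielsen i j hij))
        {AdmissibleSet.base (stretched hij ε)} (n + 1) := by
  rw [← Set.ncard_coe_finset]
  refine Set.ncard_le_ncard_of_injOn
    (fun L => leftAction _ (nielsen i j hij (mk L)) (AdmissibleSet.base _)) ?_ ?_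
    (ball_finite _ (Set.finite_singleton _) _)
  · intro L hL
    obtain ⟨-, h2, h3, -⟩ := reachable_of_mem_prependings hij hε hε1 hL
    refine ⟨_, rfl, (nielsen i j hij (mk L))⁻¹, ?_, by rw [op_smul_eq, inv_inv]⟩
    change ((nielsen i j hij).symm (nielsen i j hij (mk L))⁻¹).norm ≤ n + 1
    rw [_root_.map_inv, MulEquiv.symm_apply_apply, norm_inv_eq, ← h3]
    exact norm_mk_le
  · intro L hL L' hL' h
    obtain ⟨h1, h2, -⟩ := reachable_of_mem_prependings hij hε hε1 hL
    obtain ⟨h1', h2', -⟩ := reachable_of_mem_prependings hij hε hε1 hL'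
    have h3 := congrArg AdmissibleSet.val h
    simp only [h1.2, h1'.2] at h3
    have h4 := congrArg toWord ((nielsen i j hij).injective h3)
    rwa [toWord_mk, toWord_mk, h2.reduce_eq, h2'.reduce_eq] at h4

theorem ncard_stretched_le (hι : 1 < Fintype.card ι) {ε : ℝ} (hε : 0 < ε) (n : ℕ) :
    ({u : FreeGroup ι | u ∈ stretched hij ε ∧ u.norm ≤ n}.ncard : ℝ) ≤
      3 * (2 * Fintype.card ι - 1 : ℝ) ^ ((n + (7 + 2 * ε)) / (1 + ε)) := by
  have hι' : (2 : ℝ) ≤ Fintype.card ι := by exact_mod_cast hι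
  have hx : 0 ≤ (n + (7 + 2 * ε)) / (1 + ε) := by positivity
  set m : ℕ := ⌊(n + (7 + 2 * ε)) / (1 + ε)⌋₊ with hm
  have h1 : {u : FreeGroup ι | u ∈ stretched hij ε ∧ u.norm ≤ n}.ncard ≤
      {u : FreeGroup ι | u.norm ≤ m}.ncard := by
    refine Set.ncard_le_ncard_of_injOn (nielsen i j hij).symm ?_
      (nielsen i j hij).symm.injective.injOn (finite_norm_le m)
    rintro u ⟨hu, hun⟩
    refine Nat.le_floor ?_
    rw [le_div_iff₀ (by linarith), mul_comm]
    have h2 : (u.norm : ℝ) ≤ n := by exact_mod_cast hun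
    exact le_trans hu (by linarith)
  refine (Nat.cast_le.2 h1).trans ((ncard_norm_le hι m).trans ?_)
  rw [← Real.rpow_natCast]
  exact mul_le_mul_of_nonneg_left
    (Real.rpow_le_rpow_of_exponent_le (by linarith) (Nat.floor_le hx)) (by norm_num)

theorem exists_growthFunction_le_pow (hι : 1 < Fintype.card ι) {ε : ℝ} (hε : 0 < ε) :
    ∃ σ : ℝ, 0 < σ ∧ σ < 2 * Fintype.card ι - 1 ∧
      ∀ A : Set (AdmissibleSet (stretched hij ε)), A.Finite → ∃ N : ℕ, ∀ n : ℕ, N ≤ n →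
        (growthFunction (FreeGroupBasis.ofFreeGroup ι) A n : ℝ) ≤ σ ^ n := by
  have hι' : (2 : ℝ) ≤ Fintype.card ι := by exact_mod_cast hι
  obtain ⟨q, hq⟩ : ∃ q : ℝ, q = 2 * Fintype.card ι - 1 := ⟨_, rfl⟩
  have hq1 : 1 < q := by linarith
  have hq0 : 0 < q := by linarith
  rw [← hq]
  set τ : ℝ := q ^ (1 / (1 + ε)) with hτ
  have hτ0 : 0 < τ := Real.rpow_pos_of_pos hq0 _
  have hτq : τ < q := by
    have h1 : 1 / (1 + ε) < 1 := by rw [div_lt_one (by linarith)]; linarith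
    exact (Real.rpow_lt_rpow_of_exponent_lt hq1 h1).trans_eq (Real.rpow_one q)
  -- Any rate strictly between `τ = q ^ (1 / (1 + ε))` and `q` works: it leaves room for the linear
  -- factor and for the constants depending on `A`, while staying independent of `A`.
  refine ⟨(τ + q) / 2, by linarith, by linarith, fun A hA => ?_⟩
  obtain ⟨D, hD⟩ := exists_norm_le_of_finite hA
  set K : ℝ := 2 * Fintype.card ι * 3 * q ^ ((D + (7 + 2 * ε)) / (1 + ε)) with hK
  obtain ⟨N, hN⟩ := Filter.eventually_atTop.1
    (eventually_linear_mul_pow_le K (D + 1) hτ0 (show τ < (τ + q) / 2 by linarith))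
  refine ⟨N, fun n hn => le_trans ?_ (hN n hn)⟩
  have : Nonempty ι := ⟨i⟩
  have h1 : growthFunction (FreeGroupBasis.ofFreeGroup ι) A n ≤ _ :=
    (Set.ncard_le_ncard (hD n) (finite_admissible_norm_le _)).trans
      (ncard_admissible_norm_le (one_mem_stretched hij hε.le) (n + D))
  have h2 := ncard_stretched_le hij hι hε (n + D)
  have h3 : q ^ (((n + D : ℕ) + (7 + 2 * ε)) / (1 + ε)) =
      q ^ ((D + (7 + 2 * ε)) / (1 + ε)) * τ ^ n := by
    rw [hτ, ← Real.rpow_natCast, ← Real.rpow_mul hq0.le, ← Real.rpow_add hq0]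
    congr 1
    push_cast
    field_simp
    ring
  rw [← hq, h3] at h2
  refine (Nat.cast_le.2 h1).trans ?_
  push_cast
  refine (mul_le_mul_of_nonneg_left h2 (by positivity)).trans_eq ?_
  rw [hK]
  ring

end Stretched

end ActGrowth

/-! ### Assembly -/

theorem mainTheorem9 (r : ℕ) (hr : 1 < r) :
    ∃ (S : Type) (_ : MulAction (FreeGroup (Fin r))ᵐᵒᵖ S),
      Nonempty S ∧ MulAction.IsPretransitive (FreeGroup (Fin r))ᵐᵒᵖ S ∧
      ActGrowth.HasMaximalGrowth
        ((ActGrowth.standardBasis r).map (ActGrowth.nielsenAut r hr)) S ∧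
      (∃ γ : ℝ, 0 < γ ∧
        ∀ A : Set S, A.Finite → ActGrowth.IsGeneratingSet (FreeGroup (Fin r)) A →
          ∃ N : ℕ, ∀ n : ℕ, N ≤ n →
            (ActGrowth.growthFunction (ActGrowth.standardBasis r) A n : ℝ) ≤
              (2 * (r : ℝ) - 1 - γ) ^ n) ∧
      ¬ ActGrowth.HasMaximalGrowth (ActGrowth.standardBasis r) S ∧
      ∃ (T : Type) (_ : MulAction (FreeGroup (Fin r))ᵐᵒᵖ T) (f : T ≃ S),
        ActGrowth.IsSemiIsomorphism (ActGrowth.nielsenAut r hr) f ∧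
        MulAction.IsPretransitive (FreeGroup (Fin r))ᵐᵒᵖ T ∧
        ActGrowth.HasMaximalGrowth (ActGrowth.standardBasis r) T := by
  have hι : 1 < Fintype.card (Fin r) := by rwa [Fintype.card_fin]
  have hij : (⟨0, by omega⟩ : Fin r) ≠ ⟨1, hr⟩ := by simp
  obtain ⟨ε, hε, hε1, c, hc, hcard⟩ := ActGrowth.exists_le_card_prependings hij hι
  obtain ⟨σ, hσ, hσq, hσA⟩ := ActGrowth.exists_growthFunction_le_pow hij hι hε
  set G := ActGrowth.stretched hij ε
  set s := ActGrowth.AdmissibleSet.base G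
  set q : ℝ := 2 * Fintype.card (Fin r) - 1 with hq
  have hq0 : 0 < q := hσ.trans hσq
  have hq1 : 1 ≤ q := by
    have : (2 : ℝ) ≤ Fintype.card (Fin r) := by exact_mod_cast hι
    linarith
  -- Dividing by `q` compensates for the radius shift `n + 1`, and the minimum with 1 covers radius
  -- 0.
  have hpos : 0 < min c 1 / q := div_pos (lt_min hc one_pos) hq0
  have hlow : ∀ n : ℕ, min c 1 / q * q ^ n ≤ ActGrowth.growthFunction
      ((ActGrowth.standardBasis r).map (ActGrowth.nielsenAut r hr)) {s} n := by
    rintro (_ | n)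
    · have h1 : 1 ≤ ActGrowth.growthFunction
          ((ActGrowth.standardBasis r).map (ActGrowth.nielsenAut r hr)) {s} 0 := by
        refine (Set.ncard_pos (ActGrowth.ball_finite _ (Set.finite_singleton _) _)).2 ?_
        exact ⟨s, s, rfl, 1, by simp [ActGrowth.filtration], by simp⟩
      rw [pow_zero, mul_one]
      refine le_trans ?_ (Nat.one_le_cast.2 h1)
      rw [div_le_one hq0]
      exact (min_le_right c 1).trans hq1
    · rw [pow_succ', ← mul_assoc, div_mul_cancel₀ _ hq0.ne']
      calc _ ≤ c * q ^ n := mul_le_mul_of_nonneg_right (min_le_left c 1) (by positivity)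
        _ ≤ _ := hcard n
        _ ≤ _ := Nat.cast_le.2 (ActGrowth.card_prependings_le_growthFunction hij hε.le hε1 n)
  -- The lower bound for balls of `F` comes for free, since an orbit ball in `S` is no larger than
  -- the ball of `F`.
  have hreg : ∀ n : ℕ, min c 1 / q * q ^ n ≤
      {g : FreeGroup (Fin r) | g.norm ≤ n}.ncard := fun n =>
    (hlow n).trans (Nat.cast_le.2 (ActGrowth.growthFunction_singleton_le _ s n))
  have hgen : ActGrowth.IsGeneratingSet (FreeGroup (Fin r)) {s} := fun t => by
    obtain ⟨g, hg⟩ := MulAction.exists_smul_eq (FreeGroup (Fin r))ᵐᵒᵖ s t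
    exact ⟨s, rfl, g.unop, hg⟩
  refine ⟨ActGrowth.AdmissibleSet G, inferInstance, ⟨s⟩, inferInstance,
    ActGrowth.hasMaximalGrowth_of_le _ hι s hpos hlow, ⟨q - σ, sub_pos.2 hσq, ?_⟩, ?_,
    ActGrowth.Twist (ActGrowth.nielsenAut r hr) (ActGrowth.AdmissibleSet G), inferInstance,
    ActGrowth.untwist _, ActGrowth.untwist_op_smul _, inferInstance, ?_⟩
  · intro A hA _
    have h1 : 2 * (r : ℝ) - 1 - (q - σ) = σ := by
      rw [hq, Fintype.card_fin]
      ring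
    rw [h1]
    exact hσA A hA
  · obtain ⟨N, hN⟩ := hσA {s} (Set.finite_singleton s)
    exact ActGrowth.not_hasMaximalGrowth_of_le _ (Set.finite_singleton s) hgen hpos hreg hσ hσq hN
  · refine ActGrowth.hasMaximalGrowth_of_le _ hι ((ActGrowth.untwist _).symm s) hpos fun n => ?_
    refine (hlow n).trans_eq ?_
    rw [← ActGrowth.growthFunction_twist]
    congr 2
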